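/- Consider words over the alphabet $\{1,2,3\}$ (the qutrit pair-flip model). The irreducible string of a word is obtained by reading the word from left to right with an initially empty stack: the letter read is pushed onto the stack unless it equals the letter on top of the stack, in which case the stack is popped; the final content of the stack, read from bottom to top, is the irreducible string. A string is irreducible if no two adjacent letters are equal. For an irreducible string $x$ and $n\ge 1$, let $\langle\#\rangle_{n,x}$ be the average, over all words of length $2n$ whose irreducible string is $x$, of the number of adjacent identical pairs (positions $1\le i<2n$ whose letters number $i$ and $i+1$ are equal), and let $\langle\#\rangle_{n,\varnothing}$ be this average for the empty string. Put $$m_n(k)=\frac{3n}{4}+\frac34-\frac{3\,(k^3+9k^2+50k+144)}{16\,(k+3)\,n}.$$ There are constants $C,C',c_1,c_2>0$ such that for every bound $K$ there is $N\geq 1$ such that for all $n\ge N$, all even $k$ with $0\le k\le K$ and all irreducible strings $x$ with $k$ letters, there are words of length $2n$ with irreducible string $x$ and: 1. $\bigl|\langle\#\rangle_{n,x}-m_n(k)\bigr|\le C\,\dfrac{k^4+1}{n^2}$, that is, for constant $k$ the average number of pairs is $m_n(k)+O\bigl((k^4+1)n^{-2}\bigr)$. 2. The average is maximal for $k=0$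 and decreases with $k$: $\langle\#\rangle_{n,x}<\langle\#\rangle_{n,\varnothing}$ if $k>0$, and $\langle\#\rangle_{n,x}<\langle\#\rangle_{n,y}$ for every irreducible string $y$ with an even number $j<k$ of letters. (Also, for each $n\ge1$ the expression $m_n(k)$ is strictly decreasing in $k\in\mathbb N_0$.) 3. The difference is of order $k^2/n$ and about $3k^2/(16n)$: $$c_1\frac{k^2}{n}\le\langle\#\rangle_{n,\varnothing}-\langle\#\rangle_{n,x}\le c_2\frac{k^2}{n},\qquad \left|\langle\#\rangle_{n,\varnothing}-\langle\#\rangle_{n,x}-\frac{3k^2}{16n}\right|\le C'\,\frac{k}{n}.$$ -/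

import Mathlib

namespace PairFlip

/-- One step of the pushdown automaton that reads a pair-flip word from left to right: the letter
that is read is pushed onto the stack (the head of the list is the top of the stack), unless it
equals the letter on top, in which case the stack is popped. -/
def stackStep {d : ℕ} : List (Fin d) → Fin d → List (Fin d)
  | [], a => [a]
  | s :: σ, a => if a = s then σ else a :: s :: σ

/-- The irreducible string of a word: what is left on the stack after the whole word has been
read, starting from the empty stack, listed from the bottom of the stack to its top. -/
def irreducibleString {d : ℕ} (w : List (Fin d)) : List (Fin d) :=
  (w.foldl stackStep []).reverse

/-- The number of adjacent identical pairs in a word, that is, the number of positions `i` such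
that the letters number `i` and `i + 1` are equal (overlapping pairs are all counted). -/
def pairCount {d : ℕ} : List (Fin d) → ℕ
  | [] => 0
  | [_] => 0
  | a :: b :: l => (if a = b then 1 else 0) + pairCount (b :: l)

/-- The words of length `N` over the alphabet with `d` letters whose irreducible string is `x`:
the computational basis of the invariant subspace of the pair-flip model labelled by `x`. -/
def words {d : ℕ} (N : ℕ) (x : List (Fin d)) : Finset (Fin N → Fin d) :=
  Finset.univ.filter fun w => irreducibleString (List.ofFn w) = x

/-- The average number of adjacent identical pairs over all words of length `N` whose irreducible
string is `x`. -/
noncomputable def averagePairs {d : ℕ} (N : ℕ) (x : List (Fin d)) : ℝ :=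
  (∑ w ∈ words N x, (pairCount (List.ofFn w) : ℝ)) / ((words N x).card : ℝ)

/-- A possible irreducible string with `k` letters: no letter is immediately repeated. -/
def IsIrreducible {d : ℕ} (k : ℕ) (x : List (Fin d)) : Prop :=
  x.length = k ∧ x.IsChain (· ≠ ·)

/-- The main terms `3n/4 + 3/4 - 3(k³ + 9k² + 50k + 144) / (16(k+3)n)` of the average. -/
noncomputable def mainTerm (n k : ℕ) : ℝ :=
  3 * (n : ℝ) / 4 + 3 / 4
    - 3 * ((k : ℝ) ^ 3 + 9 * (k : ℝ) ^ 2 + 50 * (k : ℝ) + 144) / (16 * ((k : ℝ) + 3) * (n : ℝ))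

end PairFlip

/-!
Reading a letter acts on irreducible strings as an involution, so words are walks on the
`3`-regular tree (the Cayley graph of the free product of three groups of order two), and the number
of words with a given irreducible string depends only on its length (`card_words`). An adjacent
identical pair can be cut out of a word without changing its irreducible string. Hence the average
over words of length `N + 2` is `3 (N + 1) walks N k / walks (N + 2) k` (`averagePairs_add_two`), and
what is needed is an expansion of this ratio up to and including the terms of relative order
`1 / N ^ 3`.

Let `A n` count the closed walks of length `2 n` and let `S = 8 - shift`, acting on sequences. The
sequence `c = (1 + S) A = 9 A n - A (n + 1)`, called `excess`, has a closed form by the ballot theorem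
(`walks_sub_walks`), and the iterates `S ^ m c` are explicit rational multiples of `c`, of order
`c / n ^ m` (`defect_pow_excess`). Since `A n ≤ 8 ^ n`, the unstable recursion
`A (n + 1) = 9 A n - c n` can be solved backwards from infinity, which gives `S ^ m A = O(c / n ^ m)`
(`defect_pow_scaledWalks_mem_scale`). The walks to distance `2 j` are, up to the factor `2 ^ j`, a
polynomial in `S` applied to `A`; expanding this polynomial divided by `1 + S` in powers of `S` gives
their expansion in the scale `c, S c, S ^ 2 c`, with a remainder that gains another factor `1 / n` when
`S` is applied (`remainder_mem_smooth`).

As `a (n + 1) = 8 a n - S a n`, the average is a rational function of `n` up to controlled remainders,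
and `n ^ 2` times its distance to the main terms converges (`tendsto_meanPairs`). The limit is
`O(k ^ 4 + 1)`, whence the uniform constant of the expansion. The comparisons between different `k`
follow from the main terms.
-/

namespace PairFlip

open Finset Filter Asymptotics

/-! ### Words as walks on the tree of irreducible strings -/

lemma isChain_stackStep {d : ℕ} {σ : List (Fin d)} (hσ : σ.IsChain (· ≠ ·)) (a : Fin d) :
    (stackStep σ a).IsChain (· ≠ ·) := by
  cases σ with
  | nil => simp [stackStep]
  | cons s σ =>
    by_cases h : a = s
    · simpa [stackStep, h] using hσ.tail
    · simpa [stackStep, h] using hσ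

/-- On irreducible stacks, reading the same letter twice changes nothing: each letter acts as an
involution. -/
lemma stackStep_stackStep {d : ℕ} {σ : List (Fin d)} (hσ : σ.IsChain (· ≠ ·)) (a : Fin d) :
    stackStep (stackStep σ a) a = σ := by
  cases σ with
  | nil => simp [stackStep]
  | cons s σ =>
    by_cases h : a = s
    · subst h
      cases σ with
      | nil => simp [stackStep]
      | cons t σ =>
        have : a ≠ t := by simpa using (List.isChain_cons_cons.1 hσ).1
        simp [stackStep, this]
    · simp [stackStep, h]

lemma isChain_foldl_stackStep {d : ℕ} (w : List (Fin d)) {σ : List (Fin d)}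
    (hσ : σ.IsChain (· ≠ ·)) : (w.foldl stackStep σ).IsChain (· ≠ ·) := by
  induction w generalizing σ with
  | nil => simpa
  | cons a w ih => exact ih (isChain_stackStep hσ a)

/-- Reading `a` leads to `σ` exactly from the stack that `a` makes out of `σ`. -/
lemma stackStep_eq_iff {d : ℕ} {σ τ : List (Fin d)} (hσ : σ.IsChain (· ≠ ·))
    (hτ : τ.IsChain (· ≠ ·)) (a : Fin d) : stackStep τ a = σ ↔ τ = stackStep σ a :=
  ⟨fun h => by rw [← h, stackStep_stackStep hτ], fun h => by rw [h, stackStep_stackStep hσ]⟩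

/-- The sum of `F` over the words of length `N` that lead from the empty stack to `σ`. -/
def stackSum {d : ℕ} (N : ℕ) (σ : List (Fin d)) (F : List (Fin d) → ℕ) : ℕ :=
  ∑ w : Fin N → Fin d,
    if (List.ofFn w).foldl stackStep [] = σ then F (List.ofFn w) else 0

lemma sum_ofFn_succ {d N : ℕ} (F : List (Fin d) → ℕ) :
    ∑ w : Fin (N + 1) → Fin d, F (List.ofFn w)
      = ∑ a : Fin d, ∑ w : Fin N → Fin d, F (List.ofFn w ++ [a]) := by
  rw [← Fintype.sum_prod_type', ← (Fin.snocEquiv fun _ : Fin (N + 1) => Fin d).sum_comp]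
  refine Fintype.sum_congr _ _ fun p => ?_
  simp only [Fin.snocEquiv, Equiv.coe_fn_mk]
  rw [List.ofFn_succ', List.concat_eq_append]
  simp

lemma stackSum_succ {d N : ℕ} {σ : List (Fin d)} (hσ : σ.IsChain (· ≠ ·))
    (F : List (Fin d) → ℕ) :
    stackSum (N + 1) σ F = ∑ a : Fin d, stackSum N (stackStep σ a) fun w => F (w ++ [a]) := by
  unfold stackSum
  rw [sum_ofFn_succ fun w => if w.foldl stackStep [] = σ then F w else 0]
  simp only [List.foldl_append, List.foldl_cons, List.foldl_nil,
    stackStep_eq_iff hσ (isChain_foldl_stackStep _ List.isChain_nil)]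

lemma pairCount_append_pair {d : ℕ} (w : List (Fin d)) (b a : Fin d) :
    pairCount (w ++ [b] ++ [a]) = pairCount (w ++ [b]) + if b = a then 1 else 0 := by
  induction w with
  | nil => simp [pairCount]
  | cons c w ih =>
    cases w with
    | nil => simp [pairCount]
    | cons e w =>
      simp only [List.cons_append, pairCount] at ih ⊢
      rw [ih, add_assoc]

lemma stackSum_add {d N : ℕ} (σ : List (Fin d)) (F G : List (Fin d) → ℕ) :
    stackSum N σ (fun w => F w + G w) = stackSum N σ F + stackSum N σ G := by
  simp only [stackSum, ← sum_add_distrib]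
  exact Fintype.sum_congr _ _ fun w => by split_ifs <;> simp

/-- Inserting a pair `aa` at one of the `N + 1` places of a word of length `N` does not change its
stack, and every adjacent identical pair arises in this way. The induction splits off the last
letter. -/
lemma stackSum_pairCount {d N : ℕ} {σ : List (Fin d)} (hσ : σ.IsChain (· ≠ ·)) :
    stackSum (N + 2) σ pairCount = d * (N + 1) * stackSum N σ fun _ => 1 := by
  -- the pair formed by the last two letters, summed over all words
  have split : ∀ {N : ℕ} {σ : List (Fin d)}, σ.IsChain (· ≠ ·) →
      stackSum (N + 2) σ pairCount
        = ∑ a, stackSum (N + 1) (stackStep σ a) pairCount + d * stackSum N σ fun _ => 1 := by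
    intro N σ hσ
    rw [stackSum_succ hσ]
    have : ∀ a, stackSum (N + 1) (stackStep σ a) (fun w => pairCount (w ++ [a]))
        = stackSum (N + 1) (stackStep σ a) pairCount + stackSum N σ fun _ => 1 := by
      intro a
      have hσa := isChain_stackStep hσ a
      rw [stackSum_succ hσa, stackSum_succ hσa]
      simp only [pairCount_append_pair, stackSum_add, sum_add_distrib]
      congr 1
      rw [sum_eq_single a]
      · simp [stackStep_stackStep hσ]
      · intro b _ hb
        simp [hb, stackSum]
      · simp
    simp [this, sum_add_distrib]
  induction N generalizing σ with
  | zero =>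
    rw [split hσ]
    have : ∀ τ : List (Fin d), stackSum (0 + 1) τ pairCount = 0 := by
      intro τ
      simp [stackSum, List.ofFn_succ, pairCount]
    simp [this]
  | succ N ih =>
    rw [split hσ, sum_congr rfl fun a _ => ih (isChain_stackStep hσ a), ← mul_sum,
      stackSum_succ hσ]
    ring

/-- The number of walks of length `N` from the root of the `3`-regular tree to a given vertex at
distance `k`. -/
def walks : ℕ → ℕ → ℕ
  | 0, 0 => 1
  | 0, _ + 1 => 0
  | N + 1, 0 => 3 * walks N 1
  | N + 1, k + 1 => walks N k + 2 * walks N (k + 2)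

lemma stackSum_one {N : ℕ} {σ : List (Fin 3)} (hσ : σ.IsChain (· ≠ ·)) :
    (stackSum N σ fun _ => 1) = walks N σ.length := by
  induction N generalizing σ with
  | zero => cases σ <;> simp [stackSum, walks]
  | succ N ih =>
    rw [stackSum_succ hσ, sum_congr rfl fun a _ => ih (isChain_stackStep hσ a)]
    cases σ with
    | nil => simp [stackStep, walks]
    | cons s σ =>
      simp only [stackStep, List.length_cons, walks]
      fin_cases s <;> simp [Fin.sum_univ_three] <;> ring

lemma card_words {N k : ℕ} {x : List (Fin 3)} (hx : IsIrreducible k x) :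
    (words N x).card = walks N k := by
  have hc : x.reverse.IsChain (· ≠ ·) := by
    rw [List.isChain_reverse]; exact hx.2.imp fun _ _ h => h.symm
  have := stackSum_one (N := N) hc
  rw [List.length_reverse, hx.1] at this
  rw [← this, words, card_filter, stackSum]
  simp only [irreducibleString, List.reverse_eq_iff]

/-- The average number of pairs is, up to the factor `3 (N + 1)`, a ratio of two numbers of
walks. -/
lemma averagePairs_add_two {N k : ℕ} {x : List (Fin 3)} (hx : IsIrreducible k x) :
    averagePairs (N + 2) x = 3 * ((N : ℝ) + 1) * walks N k / walks (N + 2) k := by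
  have hc : x.reverse.IsChain (· ≠ ·) := by
    rw [List.isChain_reverse]; exact hx.2.imp fun _ _ h => h.symm
  have h := stackSum_pairCount (N := N) hc
  rw [stackSum_one hc, List.length_reverse, hx.1] at h
  have h' : ∑ w ∈ words (N + 2) x, pairCount (List.ofFn w) = 3 * (N + 1) * walks N k := by
    rw [← h, words, sum_filter, stackSum]
    simp only [irreducibleString, List.reverse_eq_iff]
  rw [averagePairs, card_words hx]
  congr 1
  exact_mod_cast h'

/-! ### The weighted ballot numbers -/

lemma walks_eq_zero {N k : ℕ} (h : N < k) : walks N k = 0 := by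
  induction N generalizing k with
  | zero => cases k with
    | zero => omega
    | succ k => rfl
  | succ N ih => cases k with
    | zero => omega
    | succ k => simp [walks, ih (show N < k by omega), ih (show N < k + 2 by omega)]

lemma walks_self (k : ℕ) : walks k k = 1 := by
  induction k with
  | zero => rfl
  | succ k ih => simp [walks, ih, walks_eq_zero (show k < k + 2 by omega)]

lemma walks_add_two_zero (N : ℕ) : walks (N + 2) 0 = 3 * walks N 0 + 6 * walks N 2 := by
  simp only [walks]; ring

lemma walks_add_two_add_two (N k : ℕ) :
    walks (N + 2) (k + 2) = walks N k + 4 * walks N (k + 2) + 4 * walks N (k + 4) := by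
  simp only [walks]; ring

/-- The differences `walks N k - walks N (k + 2)` satisfy the recursion of walks on the half-line
that step down with weight `2`, whence a closed form by the ballot theorem. -/
lemma walks_sub_walks (N : ℕ) : ∀ k m : ℕ, k + 2 * m = N →
    (walks N k : ℝ) - walks N (k + 2)
      = 2 ^ m * (k + 1) * N.factorial / (m.factorial * (k + m + 1).factorial) := by
  induction N with
  | zero =>
    intro k m h
    obtain ⟨rfl, rfl⟩ : k = 0 ∧ m = 0 := by omega
    simp [walks]
  | succ N ih =>
    intro k m h
    rcases m with _ | m
    · obtain rfl : k = N + 1 := by omega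
      rw [walks_self, walks_eq_zero (by omega)]
      have := Nat.factorial_ne_zero (N + 1)
      have h2 : ((N + 1 + 1).factorial : ℝ) = (N + 2) * (N + 1).factorial := by
        rw [Nat.factorial_succ]; push_cast; ring
      simp only [add_zero, h2]
      push_cast
      field_simp
      ring
    · have hm : ((m + 1).factorial : ℝ) = (m + 1) * m.factorial := by
        rw [Nat.factorial_succ]; push_cast; ring
      have hN : ((N + 1).factorial : ℝ) = (N + 1) * N.factorial := by
        rw [Nat.factorial_succ]; push_cast; ring
      have hm0 := Nat.factorial_ne_zero m
      rcases k with _ | k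
      · have h1 := ih 1 m (by omega)
        have hk : ((0 + (m + 1) + 1).factorial : ℝ) = (1 + m + 1).factorial := by
          rw [show 0 + (m + 1) + 1 = 1 + m + 1 by ring]
        have h0 := Nat.factorial_ne_zero (1 + m + 1)
        have hNm : (N : ℝ) = 2 * m + 1 := by
          have : N = 2 * m + 1 := by omega
          exact_mod_cast this
        have e : (walks (N + 1) 0 : ℝ) - walks (N + 1) (0 + 2)
            = 2 * ((walks N 1 : ℝ) - walks N (1 + 2)) := by
          simp only [walks]; push_cast; ring
        rw [e, h1, hk, hm, hN, hNm]
        push_cast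
        field_simp
        ring
      · have h1 := ih k (m + 1) (by omega)
        have h2 := ih (k + 2) m (by omega)
        have hk : ((k + 1 + (m + 1) + 1).factorial : ℝ)
            = (k + m + 3) * (k + (m + 1) + 1).factorial := by
          rw [show k + 1 + (m + 1) + 1 = (k + (m + 1) + 1) + 1 by ring, Nat.factorial_succ]
          push_cast; ring
        have hk' : ((k + 2 + m + 1).factorial : ℝ)
            = (k + m + 3) * (k + (m + 1) + 1).factorial := by
          rw [← hk]; congr 2; ring
        have h0 := Nat.factorial_ne_zero (k + (m + 1) + 1)
        have hNm : (N : ℝ) = 2 * m + k + 2 := by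
          have : N = 2 * m + k + 2 := by omega
          exact_mod_cast this
        have e : (walks (N + 1) (k + 1) : ℝ) - walks (N + 1) (k + 1 + 2)
            = ((walks N k : ℝ) - walks N (k + 2))
              + 2 * ((walks N (k + 2) : ℝ) - walks N (k + 2 + 2)) := by
          simp only [walks]; push_cast; ring
        rw [e, h1, h2, hk, hk', hm, hN, hNm]
        push_cast
        field_simp
        ring

/-- The sequence `9 A n - A (n + 1)`, where `A n` counts the closed walks of length `2 n`. It is
`6 · 2ⁿ` times the `n`-th Catalan number. -/
noncomputable def excess (n : ℕ) : ℝ := 9 * walks (2 * n) 0 - walks (2 * (n + 1)) 0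

lemma excess_eq (n : ℕ) :
    excess n = 6 * (2 ^ n * (2 * n).factorial / (n.factorial * (n + 1).factorial)) := by
  have h := walks_sub_walks (2 * n) 0 n (by ring)
  simp only [zero_add, Nat.cast_zero, mul_one] at h
  rw [← h, excess, mul_add, mul_one, walks_add_two_zero]
  push_cast
  ring

lemma excess_pos (n : ℕ) : 0 < excess n := by
  rw [excess_eq]; positivity

lemma excess_succ (n : ℕ) : excess (n + 1) = (8 - 12 / ((n : ℝ) + 2)) * excess n := by
  have h1 : ((2 * (n + 1)).factorial : ℝ) = (2 * n + 2) * ((2 * n + 1) * (2 * n).factorial) := by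
    rw [show 2 * (n + 1) = (2 * n + 1) + 1 by ring, Nat.factorial_succ, Nat.factorial_succ]
    push_cast; ring
  have h2 : ((n + 1 + 1).factorial : ℝ) = (n + 2) * (n + 1).factorial := by
    rw [Nat.factorial_succ]; push_cast; ring
  have h3 : ((n + 1).factorial : ℝ) = (n + 1) * n.factorial := by
    rw [Nat.factorial_succ]; push_cast; ring
  have h0 := Nat.factorial_ne_zero n
  rw [excess_eq, excess_eq, h1, h2, h3]
  field_simp
  ring

/-! ### The operator `8 - shift` and the size of its iterates -/

/-- The operator `8 - shift` on sequences. It turns an asymptotic scale into the next smaller one,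
since the sequences at hand grow like `8ⁿ` up to powers of `n`. -/
def defect : Module.End ℝ (ℕ → ℝ) where
  toFun f n := 8 * f n - f (n + 1)
  map_add' f g := by ext n; simp only [Pi.add_apply]; ring
  map_smul' r f := by ext n; simp only [Pi.smul_apply, smul_eq_mul, RingHom.id_apply]; ring

lemma defect_apply (f : ℕ → ℝ) (n : ℕ) : defect f n = 8 * f n - f (n + 1) := rfl

lemma defect_pow_excess (m n : ℕ) :
    (defect ^ m) excess n = (∏ i ∈ range m, (8 * i + 12) / ((n : ℝ) + 2 + i)) * excess n := by
  induction m generalizing n with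
  | zero => simp
  | succ m ih =>
    -- the product telescopes under a shift of `n`
    have shift : ∀ m : ℕ, (∏ i ∈ range m, (8 * (i : ℝ) + 12) / (((n + 1 : ℕ) : ℝ) + 2 + i))
        = (∏ i ∈ range m, (8 * (i : ℝ) + 12) / ((n : ℝ) + 2 + i)) * ((n + 2) / (n + 2 + m)) := by
      intro m
      induction m with
      | zero => simp; field_simp
      | succ m ihm =>
        rw [prod_range_succ, prod_range_succ, ihm]
        push_cast
        field_simp
        ring
    rw [pow_succ', Module.End.mul_apply, defect_apply, ih, ih, shift, excess_succ,
      prod_range_succ]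
    field_simp
    ring

/-- The sequences that are `O(excess n / (n + 1) ^ m)`. -/
def scale (m : ℕ) : Submodule ℝ (ℕ → ℝ) where
  carrier := {f | f =O[atTop] fun n : ℕ => excess n / ((n : ℝ) + 1) ^ m}
  add_mem' := fun h h' => IsBigO.add h h'
  zero_mem' := isBigO_zero _ _
  smul_mem' := fun r _ h => IsBigO.const_mul_left h r

lemma mem_scale {m : ℕ} {f : ℕ → ℝ} :
    f ∈ scale m ↔ f =O[atTop] fun n : ℕ => excess n / ((n : ℝ) + 1) ^ m := Iff.rfl

lemma excess_div_succ_le (m n : ℕ) :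
    excess (n + 1) / (((n + 1 : ℕ) : ℝ) + 1) ^ m ≤ 8 * (excess n / ((n : ℝ) + 1) ^ m) := by
  have h : excess (n + 1) ≤ 8 * excess n := by
    rw [excess_succ]
    have := excess_pos n
    gcongr
    have : 0 ≤ 12 / ((n : ℝ) + 2) := by positivity
    linarith
  rw [← mul_div_assoc]
  have := excess_pos n
  gcongr
  linarith

lemma defect_mem_scale {m : ℕ} {f : ℕ → ℝ} (hf : f ∈ scale m) : defect f ∈ scale m := by
  rw [mem_scale] at hf ⊢
  have h1 : (fun n : ℕ => f (n + 1)) =O[atTop] fun n : ℕ => excess n / ((n : ℝ) + 1) ^ m := by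
    refine (hf.comp_tendsto (tendsto_add_atTop_nat 1)).trans ?_
    refine IsBigO.of_bound 8 (Eventually.of_forall fun n => ?_)
    have h := excess_div_succ_le m n
    have p := excess_pos n
    have p' := excess_pos (n + 1)
    simp only [Function.comp_apply]
    rwa [Real.norm_of_nonneg (by positivity), Real.norm_of_nonneg (by positivity)]
  exact (hf.const_mul_left 8).sub h1

lemma abs_defect_pow_excess_le (m n : ℕ) :
    |(defect ^ m) excess n|
      ≤ (∏ i ∈ range m, (8 * (i : ℝ) + 12)) * (excess n / ((n : ℝ) + 1) ^ m) := by
  have p := excess_pos n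
  rw [defect_pow_excess, abs_of_nonneg (by positivity), prod_div_distrib, div_mul_eq_mul_div,
    mul_div_assoc]
  gcongr
  calc ((n : ℝ) + 1) ^ m = ∏ i ∈ range m, ((n : ℝ) + 1) := by simp
    _ ≤ _ := by
      refine prod_le_prod (fun _ _ => by positivity) fun i _ => ?_
      have : (0 : ℝ) ≤ i := i.cast_nonneg
      linarith

lemma defect_pow_excess_mem_scale (m : ℕ) : (defect ^ m) excess ∈ scale m := by
  refine mem_scale.2 (IsBigO.of_bound (∏ i ∈ range m, (8 * (i : ℝ) + 12))
    (Eventually.of_forall fun n => ?_))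
  have p := excess_pos n
  rw [Real.norm_eq_abs, Real.norm_of_nonneg (by positivity)]
  exact abs_defect_pow_excess_le m n

/-! ### Expansion of the numbers of walks -/

/-- The number of walks of length `2 n` to a vertex at distance `2 j`, multiplied by `2 ^ j`. -/
noncomputable def scaledWalks (j n : ℕ) : ℝ := 2 ^ j * walks (2 * n) (2 * j)

lemma scaledWalks_zero_succ (n : ℕ) :
    scaledWalks 0 (n + 1) = 3 * scaledWalks 0 n + 3 * scaledWalks 1 n := by
  simp only [scaledWalks, mul_add, mul_one, mul_zero, walks_add_two_zero]
  push_cast; ring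

lemma scaledWalks_succ_succ (j n : ℕ) :
    scaledWalks (j + 1) (n + 1)
      = 2 * scaledWalks j n + 4 * scaledWalks (j + 1) n + 2 * scaledWalks (j + 2) n := by
  simp only [scaledWalks, mul_add, mul_one, walks_add_two_add_two]
  push_cast; ring

/-- The spectral radius of the tree is `√8`. The weights `2 ^ j` make the constant function a
supersolution of the recursion. -/
lemma scaledWalks_le (j n : ℕ) : scaledWalks j n ≤ 8 ^ n := by
  induction n generalizing j with
  | zero =>
    cases j with
    | zero => simp [scaledWalks, walks]
    | succ j => simp [scaledWalks, walks, mul_add]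
  | succ n ih =>
    have p : (0 : ℝ) < 8 ^ n := by positivity
    rw [pow_succ]
    cases j with
    | zero => rw [scaledWalks_zero_succ]; linarith [ih 0, ih 1]
    | succ j => rw [scaledWalks_succ_succ]; linarith [ih j, ih (j + 1), ih (j + 2)]

lemma scaledWalks_nonneg (j n : ℕ) : 0 ≤ scaledWalks j n := by
  unfold scaledWalks; positivity

lemma excess_eq_add_defect : excess = scaledWalks 0 + defect (scaledWalks 0) := by
  ext n
  simp only [excess, Pi.add_apply, defect_apply, scaledWalks, pow_zero, one_mul, mul_zero]
  ring

lemma abs_defect_pow_scaledWalks_le (m n : ℕ) :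
    |(defect ^ m) (scaledWalks 0) n| ≤ 16 ^ m * 8 ^ n := by
  induction m generalizing n with
  | zero => simpa [abs_of_nonneg (scaledWalks_nonneg 0 n)] using scaledWalks_le 0 n
  | succ m ih =>
    rw [pow_succ', Module.End.mul_apply, defect_apply]
    refine (abs_sub _ _).trans ?_
    rw [abs_mul, abs_of_pos (by norm_num : (0 : ℝ) < 8)]
    have h1 := ih n
    have h2 := ih (n + 1)
    rw [pow_succ] at h2 ⊢
    linarith

/-- The recursion `x (n + 1) = 9 x n - y n` is unstable, so a solution that grows at most like `8ⁿ`
is determined by `y` and of the same size. -/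
lemma abs_le_of_nine_mul_sub {x y z : ℕ → ℝ} {M : ℝ} (hxy : ∀ n, 9 * x n - x (n + 1) = y n)
    (hy : ∀ n, |y n| ≤ z n) (hz : ∀ n, z (n + 1) ≤ 8 * z n) (hx : ∀ n, |x n| ≤ M * 8 ^ n)
    (n : ℕ) : |x n| ≤ z n := by
  have key : ∀ r n : ℕ, |x n| ≤ z n + (8 / 9) ^ r * (M * 8 ^ n) := by
    intro r
    induction r with
    | zero =>
      intro n
      have := (abs_nonneg _).trans (hy n)
      rw [pow_zero, one_mul]
      linarith [hx n]
    | succ r ih =>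
      intro n
      have h1 := ih (n + 1)
      have h2 : 9 * |x n| ≤ |x (n + 1)| + |y n| := by
        have : 9 * |x n| = |x (n + 1) + y n| := by
          rw [← hxy n, add_sub_cancel, abs_mul, abs_of_pos (by norm_num : (0 : ℝ) < 9)]
        rw [this]
        exact abs_add_le _ _
      have e1 : (8 / 9 : ℝ) ^ (r + 1) * (M * 8 ^ n) = (8 / 9) * ((8 / 9) ^ r * (M * 8 ^ n)) := by
        ring
      have e2 : (8 / 9 : ℝ) ^ r * (M * 8 ^ (n + 1)) = 8 * ((8 / 9) ^ r * (M * 8 ^ n)) := by ring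
      rw [e1]
      rw [e2] at h1
      linarith [hy n, hz n]
  have lim : Tendsto (fun r : ℕ => z n + (8 / 9 : ℝ) ^ r * (M * 8 ^ n)) atTop
      (nhds (z n + 0 * (M * 8 ^ n))) :=
    ((tendsto_pow_atTop_nhds_zero_of_lt_one (by norm_num) (by norm_num)).mul_const _).const_add _
  rw [zero_mul, add_zero] at lim
  exact ge_of_tendsto' lim fun r => key r n

lemma defect_pow_scaledWalks_mem_scale (m : ℕ) : (defect ^ m) (scaledWalks 0) ∈ scale m := by
  refine mem_scale.2 (IsBigO.of_bound (∏ i ∈ range m, (8 * (i : ℝ) + 12))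
    (Eventually.of_forall fun n => ?_))
  have p := excess_pos n
  rw [Real.norm_eq_abs, Real.norm_of_nonneg (by positivity)]
  refine abs_le_of_nine_mul_sub (y := (defect ^ m) excess) (fun n => ?_)
    (abs_defect_pow_excess_le m) (fun n => ?_) (abs_defect_pow_scaledWalks_le m) n
  · have : (defect ^ m) excess
        = (defect ^ m) (scaledWalks 0) + defect ((defect ^ m) (scaledWalks 0)) := by
      conv_lhs => rw [excess_eq_add_defect, map_add]
      rw [← Module.End.mul_apply, ← Module.End.mul_apply, ← pow_succ, ← pow_succ']
    rw [this, Pi.add_apply, defect_apply]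
    ring
  · have h := excess_div_succ_le m n
    calc _ ≤ (∏ i ∈ range m, (8 * (i : ℝ) + 12)) * (8 * (excess n / ((n : ℝ) + 1) ^ m)) := by
          gcongr
      _ = _ := by ring

lemma scaledWalks_one :
    scaledWalks 1 = (5 / 3 : ℝ) • scaledWalks 0 - (1 / 3 : ℝ) • defect (scaledWalks 0) := by
  ext n
  have := scaledWalks_zero_succ n
  simp only [Pi.sub_apply, Pi.smul_apply, smul_eq_mul, defect_apply]
  linarith

lemma scaledWalks_add_two (j : ℕ) :
    scaledWalks (j + 2) = (2 : ℝ) • scaledWalks (j + 1)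
      - (1 / 2 : ℝ) • defect (scaledWalks (j + 1)) - scaledWalks j := by
  ext n
  have := scaledWalks_succ_succ j n
  simp only [Pi.sub_apply, Pi.smul_apply, smul_eq_mul, defect_apply]
  linarith

/-- The coefficient of `excess` in the expansion of `scaledWalks j`. -/
noncomputable def coeffZero (j : ℝ) : ℝ := 1 + 2 * j / 3

/-- The coefficient of `defect excess` in the expansion of `scaledWalks j`. -/
noncomputable def coeffOne (j : ℝ) : ℝ := -(2 * j ^ 3 + 9 * j ^ 2 + 25 * j + 36) / 36

/-- The coefficient of `defect ^ 2 excess` in the expansion of `scaledWalks j`. -/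
noncomputable def coeffTwo (j : ℝ) : ℝ :=
  (2 * j ^ 5 + 15 * j ^ 4 + 80 * j ^ 3 + 345 * j ^ 2 + 998 * j + 1440) / 1440

/-- What remains of `scaledWalks j` after three terms of its expansion in powers of `defect`. -/
noncomputable def remainder (j : ℕ) : ℕ → ℝ :=
  scaledWalks j - (coeffZero j • excess + coeffOne j • defect excess
    + coeffTwo j • defect (defect excess))

/-- The sequences that are of size `excess n / n ^ 3` and lose another factor `n` under
`defect`. -/
def smooth : Submodule ℝ (ℕ → ℝ) := scale 3 ⊓ (scale 4).comap defect

lemma defect_mem_smooth {f : ℕ → ℝ} (hf : f ∈ smooth) : defect f ∈ smooth :=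
  ⟨defect_mem_scale hf.1, defect_mem_scale hf.2⟩

lemma defect_pow_excess_mem_smooth : (defect ^ 3) excess ∈ smooth :=
  ⟨defect_pow_excess_mem_scale 3, defect_pow_excess_mem_scale 4⟩

/-- The coefficients are those of the formal expansion of `p j (defect) / (1 + defect)`, where
`scaledWalks j = p j (defect) (scaledWalks 0)` and `(1 + defect) (scaledWalks 0) = excess`. -/
lemma remainder_mem_smooth (j : ℕ) : remainder j ∈ smooth := by
  have h0 : (defect ^ 3) (scaledWalks 0) ∈ smooth :=
    ⟨defect_pow_scaledWalks_mem_scale 3, defect_pow_scaledWalks_mem_scale 4⟩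
  induction j using Nat.twoStepInduction with
  | zero =>
    have : remainder 0 = -(defect ^ 3) (scaledWalks 0) := by
      simp only [remainder, coeffZero, coeffOne, coeffTwo, excess_eq_add_defect, map_add,
        pow_succ, pow_zero, one_mul, Module.End.mul_apply, Nat.cast_zero]
      module
    rw [this]
    exact smooth.neg_mem h0
  | one =>
    have : remainder 1 = -(2 : ℝ) • (defect ^ 3) (scaledWalks 0) := by
      simp only [remainder, coeffZero, coeffOne, coeffTwo, excess_eq_add_defect, map_add,
        pow_succ, pow_zero, one_mul, Module.End.mul_apply, Nat.cast_one, scaledWalks_one]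
      module
    rw [this]
    exact smooth.smul_mem _ h0
  | more j ih0 ih1 =>
    have : remainder (j + 2) = (2 : ℝ) • remainder (j + 1)
        - (1 / 2 : ℝ) • defect (remainder (j + 1)) - remainder j
        - (coeffTwo (j + 1) / 2) • (defect ^ 3) excess := by
      simp only [remainder, coeffZero, coeffOne, coeffTwo, map_add, map_sub, map_smul,
        pow_succ, pow_zero, one_mul, Module.End.mul_apply, Nat.cast_add, Nat.cast_one,
        Nat.cast_ofNat, scaledWalks_add_two]
      module
    rw [this]
    exact smooth.sub_mem (smooth.sub_mem (smooth.sub_mem (smooth.smul_mem _ ih1)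
      (smooth.smul_mem _ (defect_mem_smooth ih1))) ih0)
      (smooth.smul_mem _ defect_pow_excess_mem_smooth)

/-! ### Expansion of the average -/

lemma tendsto_inv_succ : Tendsto (fun n : ℕ => 1 / ((n : ℝ) + 1)) atTop (nhds 0) :=
  tendsto_one_div_add_atTop_nhds_zero_nat

lemma tendsto_of_mem_scale {m : ℕ} {f : ℕ → ℝ} (hf : f ∈ scale (m + 1)) :
    Tendsto (fun n : ℕ => ((n : ℝ) + 1) ^ m * (f n / excess n)) atTop (nhds 0) := by
  have h : (fun n : ℕ => ((n : ℝ) + 1) ^ m * (f n / excess n))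
      =O[atTop] fun n : ℕ => 1 / ((n : ℝ) + 1) := by
    have h1 : (fun n : ℕ => ((n : ℝ) + 1) ^ m / excess n)
        =O[atTop] fun n : ℕ => ((n : ℝ) + 1) ^ m / excess n := isBigO_refl _ _
    refine (h1.mul (mem_scale.1 hf)).congr (fun n => by ring) fun n => ?_
    have := (excess_pos n).ne'
    rw [pow_succ]
    field_simp
  exact h.trans_tendsto tendsto_inv_succ

/-- The coefficient of `-1 / n` in the average. -/
noncomputable def meanCoeff (j : ℝ) : ℝ := -9 * coeffOne j / coeffZero j

/-- The coefficient of `1 / n ^ 2` in the average. -/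
noncomputable def errorCoeff (j : ℝ) : ℝ :=
  (2880 * coeffTwo j - 144 * coeffOne j + 96 * meanCoeff j * coeffOne j) / (8 * coeffZero j)

lemma coeffZero_pos (j : ℕ) : 0 < coeffZero j := by
  unfold coeffZero; positivity

lemma mainTerm_succ (n j : ℕ) :
    mainTerm (n + 1) (2 * j)
      = 3 * ((n : ℝ) + 1) / 4 + 3 / 4 - meanCoeff j * (1 / ((n : ℝ) + 1)) := by
  simp only [mainTerm, meanCoeff, coeffOne, coeffZero]
  push_cast
  field_simp
  ring

lemma scaledWalks_div_excess (j n : ℕ) :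
    scaledWalks j n / excess n = coeffZero j + coeffOne j * (12 / ((n : ℝ) + 2))
      + coeffTwo j * (240 / (((n : ℝ) + 2) * (n + 3))) + remainder j n / excess n := by
  have h1 := defect_pow_excess 1 n
  have h2 := defect_pow_excess 2 n
  simp only [pow_succ, pow_zero, one_mul, Module.End.mul_apply, prod_range_succ, prod_range_zero]
    at h1 h2
  have h0 := (excess_pos n).ne'
  simp only [remainder, Pi.sub_apply, Pi.add_apply, Pi.smul_apply, smul_eq_mul, h1, h2]
  push_cast
  field_simp
  ring

lemma defect_scaledWalks_div_excess (j n : ℕ) :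
    defect (scaledWalks j) n / excess n = coeffZero j * (12 / ((n : ℝ) + 2))
      + coeffOne j * (240 / (((n : ℝ) + 2) * (n + 3)))
      + coeffTwo j * (6720 / (((n : ℝ) + 2) * (n + 3) * (n + 4)))
      + defect (remainder j) n / excess n := by
  have h1 := defect_pow_excess 1 n
  have h2 := defect_pow_excess 2 n
  have h3 := defect_pow_excess 3 n
  simp only [pow_succ, pow_zero, one_mul, Module.End.mul_apply, prod_range_succ, prod_range_zero]
    at h1 h2 h3
  have h0 := (excess_pos n).ne'
  simp only [remainder, map_sub, map_add, map_smul, Pi.sub_apply, Pi.add_apply, Pi.smul_apply,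
    smul_eq_mul, h1, h2, h3]
  push_cast
  field_simp
  ring

/-- The explicit part of `3 (2 n + 1) a - mainTerm (n + 1) (2 j) (8 a - b)`, where
`a` and `b` are the values of `scaledWalks j` and of its image under `defect`, relative to `excess`,
divided by `x ^ 2` for `x = 1 / (n + 1)`. The choice of
`meanCoeff` cancels the terms of lower order. -/
noncomputable def explicitPart (j x : ℝ) : ℝ :=
  -12 * meanCoeff j * coeffZero j / (1 + x)
    + coeffOne j * ((-252 - 144 * x) / ((1 + x) * (1 + 2 * x)) + 96 * meanCoeff j / (1 + x)
      - 240 * meanCoeff j * x / ((1 + x) * (1 + 2 * x)))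
    + coeffTwo j * (240 * (-9 + 8 * meanCoeff j * x) / ((1 + x) * (1 + 2 * x))
      + 6720 * (3 / 4 + 3 / 4 * x - meanCoeff j * x ^ 2)
        / ((1 + x) * (1 + 2 * x) * (1 + 3 * x)))

lemma explicitPart_one_div {j m : ℝ} (hm : 0 < m) (hj : coeffZero j ≠ 0) :
    explicitPart j (1 / m)
      = m ^ 2 * ((-9 + 8 * meanCoeff j / m) * (coeffZero j + coeffOne j * (12 / (m + 1))
            + coeffTwo j * (240 / ((m + 1) * (m + 2))))
          + (3 * m / 4 + 3 / 4 - meanCoeff j / m) * (coeffZero j * (12 / (m + 1))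
            + coeffOne j * (240 / ((m + 1) * (m + 2)))
            + coeffTwo j * (6720 / ((m + 1) * (m + 2) * (m + 3))))) := by
  have hg : coeffOne j = -(meanCoeff j * coeffZero j) / 9 := by
    rw [meanCoeff, div_mul_cancel₀ _ hj]; ring
  rw [explicitPart, hg]
  field_simp
  ring

lemma tendsto_explicitPart (j : ℕ) :
    Tendsto (fun n : ℕ => explicitPart j (1 / ((n : ℝ) + 1))) atTop
      (nhds (2880 * coeffTwo j - 144 * coeffOne j + 96 * meanCoeff j * coeffOne j)) := by
  have h0 : explicitPart j 0
      = 2880 * coeffTwo j - 144 * coeffOne j + 96 * meanCoeff j * coeffOne j := by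
    have : meanCoeff j * coeffZero j = -9 * coeffOne j :=
      div_mul_cancel₀ _ (coeffZero_pos j).ne'
    simp only [explicitPart]
    norm_num
    linear_combination (-12) * this
  have hc : ContinuousAt (explicitPart j) 0 := by
    unfold explicitPart
    fun_prop (disch := norm_num)
  rw [← h0]
  exact hc.tendsto.comp tendsto_inv_succ

lemma tendsto_scaledWalks (j : ℕ) :
    Tendsto (fun n => scaledWalks j n / excess n) atTop (nhds (coeffZero j)) := by
  have hr : Tendsto (fun n => remainder j n / excess n) atTop (nhds 0) := by
    have h := (tendsto_of_mem_scale (m := 2) (remainder_mem_smooth j).1).mul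
      (tendsto_inv_succ.pow 2)
    simp only [zero_mul] at h
    refine h.congr fun n => ?_
    field_simp
  have hc : ContinuousAt (fun x : ℝ => coeffZero j + coeffOne j * (12 * x / (1 + x))
      + coeffTwo j * (240 * x ^ 2 / ((1 + x) * (1 + 2 * x)))) 0 := by
    fun_prop (disch := norm_num)
  have h := (hc.tendsto.comp tendsto_inv_succ).add hr
  simp only [mul_zero, zero_div, add_zero, ne_eq, OfNat.ofNat_ne_zero, not_false_eq_true,
    zero_pow] at h
  refine h.congr fun n => ?_
  rw [scaledWalks_div_excess]
  simp only [Function.comp_apply]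
  congr 1
  have e1 : (n : ℝ) + 2 = (n + 1) * (1 + 1 / (n + 1)) := by field_simp; ring
  have e2 : (n : ℝ) + 3 = (n + 1) * (1 + 2 * (1 / (n + 1))) := by field_simp; ring
  rw [e1, e2]
  field_simp

lemma tendsto_scaledWalks_succ (j : ℕ) :
    Tendsto (fun n => scaledWalks j (n + 1) / excess n) atTop (nhds (8 * coeffZero j)) := by
  have h8 : Tendsto (fun n : ℕ => excess (n + 1) / excess n) atTop (nhds 8) := by
    have hc : ContinuousAt (fun x : ℝ => 8 - 12 * x / (1 + x)) 0 := by
      fun_prop (disch := norm_num)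
    have h := hc.tendsto.comp tendsto_inv_succ
    simp only [mul_zero, zero_div, sub_zero] at h
    refine h.congr fun n => ?_
    have := (excess_pos n).ne'
    rw [excess_succ, Function.comp_apply, mul_div_cancel_right₀ _ this]
    field_simp
    ring
  have h := h8.mul ((tendsto_scaledWalks j).comp (tendsto_add_atTop_nat 1))
  refine h.congr fun n => ?_
  have := (excess_pos n).ne'
  have := (excess_pos (n + 1)).ne'
  simp only [Function.comp_apply]
  field_simp

/-- The average over the words of length `2 (n + 1)` with an irreducible string of length `2 j`. -/
noncomputable def meanPairs (j n : ℕ) : ℝ :=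
  3 * (2 * (n : ℝ) + 1) * scaledWalks j n / scaledWalks j (n + 1)

lemma averagePairs_eq_meanPairs {j : ℕ} (n : ℕ) {x : List (Fin 3)}
    (hx : IsIrreducible (2 * j) x) : averagePairs (2 * (n + 1)) x = meanPairs j n := by
  rw [mul_add, mul_one, averagePairs_add_two hx, meanPairs, scaledWalks, scaledWalks,
    mul_left_comm, mul_div_mul_left _ _ (by positivity)]
  push_cast
  rfl

lemma tendsto_meanPairs (j : ℕ) :
    Tendsto (fun n : ℕ => ((n : ℝ) + 1) ^ 2 * (meanPairs j n - mainTerm (n + 1) (2 * j))) atTop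
      (nhds (errorCoeff j)) := by
  have hR := tendsto_of_mem_scale (m := 2) (remainder_mem_smooth j).1
  have hS := tendsto_of_mem_scale (m := 3) (remainder_mem_smooth j).2
  have hc : ContinuousAt (fun x : ℝ => -9 + 8 * meanCoeff j * x) 0 := by fun_prop
  have hc' : ContinuousAt (fun x : ℝ => 3 / 4 + 3 / 4 * x - meanCoeff j * x ^ 2) 0 := by fun_prop
  have h1 := (hc.tendsto.comp tendsto_inv_succ).mul hR
  have h2 := (hc'.tendsto.comp tendsto_inv_succ).mul hS
  have hpos := coeffZero_pos j
  have h := (((tendsto_explicitPart j).add h1).add h2).div (tendsto_scaledWalks_succ j)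
    (by positivity)
  simp only [mul_zero, add_zero] at h
  refine h.congr' ?_
  filter_upwards [(tendsto_scaledWalks_succ j).eventually_const_lt
    (show 0 < 8 * coeffZero j by positivity)] with n hn
  have hd : scaledWalks j (n + 1) / excess n
      = 8 * (scaledWalks j n / excess n) - defect (scaledWalks j) n / excess n := by
    rw [defect_apply]; ring
  have hm : meanPairs j n * (scaledWalks j (n + 1) / excess n)
      = 3 * (2 * (n : ℝ) + 1) * (scaledWalks j n / excess n) := by
    have : scaledWalks j (n + 1) ≠ 0 := fun h0 => by simp [h0] at hn
    rw [meanPairs]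
    field_simp
  simp only [Pi.div_apply, Function.comp_apply]
  rw [div_eq_iff hn.ne', mul_assoc (_ ^ 2), sub_mul (meanPairs j n), hm, mainTerm_succ, hd,
    scaledWalks_div_excess, defect_scaledWalks_div_excess,
    explicitPart_one_div (by positivity) hpos.ne']
  field_simp
  ring

lemma abs_errorCoeff_lt (j : ℕ) : |errorCoeff j| < 10000 * (((2 * j : ℕ) : ℝ) ^ 4 + 1) := by
  have hj : (0 : ℝ) ≤ j := j.cast_nonneg
  generalize ht : (j : ℝ) = t at *
  have c0 : 0 < coeffZero t := ht ▸ coeffZero_pos j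
  have e : errorCoeff t = 360 * (coeffTwo t / coeffZero t) + 2 * meanCoeff t
      - 4 / 3 * meanCoeff t ^ 2 := by
    have : coeffZero t ≠ 0 := c0.ne'
    simp only [errorCoeff, meanCoeff]
    field_simp
    ring
  have g0 : 0 ≤ meanCoeff t := by
    have : meanCoeff t = (2 * t ^ 3 + 9 * t ^ 2 + 25 * t + 36) / (4 * (coeffZero t)) := by
      simp only [meanCoeff, coeffOne]
      have : coeffZero t ≠ 0 := c0.ne'
      field_simp
      ring
    rw [this]
    positivity
  have g1 : meanCoeff t ≤ 20 * (t ^ 2 + 1) := by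
    rw [meanCoeff, div_le_iff₀ c0, coeffOne, coeffZero]
    nlinarith [sq_nonneg (t - 1), mul_nonneg hj (sq_nonneg t)]
  have g2 : meanCoeff t ^ 2 ≤ 800 * (t ^ 4 + 1) := by
    nlinarith [pow_le_pow_left₀ g0 g1 2, sq_nonneg (t ^ 2 - 1)]
  have q0 : 0 ≤ coeffTwo t / coeffZero t := by
    unfold coeffTwo
    positivity
  have q1 : coeffTwo t / coeffZero t ≤ 4 * (t ^ 4 + 1) := by
    rw [div_le_iff₀ c0, coeffTwo, coeffZero]
    nlinarith [sq_nonneg (t ^ 2 - 1), sq_nonneg (t - 1), mul_nonneg hj (sq_nonneg (t ^ 2 - 1)),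
      mul_nonneg hj (sq_nonneg t), mul_nonneg hj (pow_nonneg hj 4), pow_nonneg hj 4]
  have g3 : t ^ 2 ≤ t ^ 4 + 1 := by nlinarith [sq_nonneg (t ^ 2 - 1)]
  have p4 : 0 ≤ t ^ 4 := by positivity
  rw [e]
  push_cast
  rw [ht]
  rw [abs_lt]
  constructor <;> nlinarith

/-- The constant in the error term is uniform because the coefficient of `1 / n ^ 2` is
`O(k ^ 4 + 1)` and beyond it only an error that tends to zero for each `k` remains. -/
lemma expansion (K : ℕ) : ∃ N : ℕ, 1 ≤ N ∧ ∀ n : ℕ, N ≤ n → ∀ k : ℕ, k ≤ K → Even k →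
    ∀ x : List (Fin 3), IsIrreducible k x →
      (words (2 * n) x).Nonempty ∧
      |averagePairs (2 * n) x - mainTerm n k| ≤ 10000 * ((k : ℝ) ^ 4 + 1) / (n : ℝ) ^ 2 := by
  have h : ∀ᶠ n : ℕ in atTop, ∀ j ∈ range (K + 1), 0 < scaledWalks j (n + 1) / excess n ∧
      |((n : ℝ) + 1) ^ 2 * (meanPairs j n - mainTerm (n + 1) (2 * j))|
        < 10000 * (((2 * j : ℕ) : ℝ) ^ 4 + 1) := by
    rw [eventually_all_finset]
    intro j _
    refine ((tendsto_scaledWalks_succ j).eventually_const_lt ?_).and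
      ((tendsto_meanPairs j).abs.eventually_lt_const (abs_errorCoeff_lt j))
    have := coeffZero_pos j
    positivity
  obtain ⟨N, hN⟩ := eventually_atTop.1 h
  refine ⟨N + 1, by omega, fun n hn k hk hke x hx => ?_⟩
  obtain ⟨n, rfl⟩ : ∃ m, n = m + 1 := ⟨n - 1, by omega⟩
  obtain ⟨j, rfl⟩ := hke.exists_two_nsmul
  rw [smul_eq_mul] at *
  obtain ⟨h1, h2⟩ := hN n (by omega) j (by simp; omega)
  constructor
  · rw [← card_pos, card_words hx, Nat.pos_iff_ne_zero]
    intro h0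
    rw [scaledWalks, h0] at h1
    simp at h1
  · rw [averagePairs_eq_meanPairs n hx, le_div_iff₀ (by positivity), mul_comm]
    rw [abs_mul, abs_of_pos (by positivity)] at h2
    push_cast at h2 ⊢
    exact h2.le

/-! ### Comparison of different lengths -/

/-- The dependence of the main terms on `k`, without its factor `-3 / (16 n)`. -/
noncomputable def profile (k : ℝ) : ℝ := k ^ 2 + 6 * k + 32 + 48 / (k + 3)

lemma mainTerm_eq (n k : ℕ) :
    mainTerm n k = 3 * (n : ℝ) / 4 + 3 / 4 - 3 / (16 * n) * profile k := by
  have h : ((k : ℝ) ^ 3 + 9 * (k : ℝ) ^ 2 + 50 * (k : ℝ) + 144) = profile k * (k + 3) := by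
    rw [profile]; field_simp; ring
  rw [mainTerm, h]
  congr 1
  have : (k : ℝ) + 3 ≠ 0 := by positivity
  rw [div_mul_eq_mul_div, show 3 * (profile k * ((k : ℝ) + 3)) = ((k : ℝ) + 3) * (3 * profile k)
    by ring, show 16 * ((k : ℝ) + 3) * n = ((k : ℝ) + 3) * (16 * n) by ring,
    mul_div_mul_left _ _ this]

lemma profile_gap {j k : ℕ} (h : j < k) : profile j + 3 ≤ profile k := by
  have h' : (j : ℝ) + 1 ≤ k := by exact_mod_cast h
  have hj : (0 : ℝ) ≤ j := j.cast_nonneg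
  have e : profile k - profile j
      = ((k : ℝ) - j) * (k + j + 6 - 48 / ((j + 3) * (k + 3))) := by
    rw [profile, profile]; field_simp; ring
  have h4 : 48 / (((j : ℝ) + 3) * (k + 3)) ≤ 4 := by
    rw [div_le_iff₀ (by positivity)]; nlinarith
  nlinarith

lemma profile_sub_zero (k : ℝ) (hk : 0 ≤ k) :
    profile k - profile 0 = k ^ 2 + 6 * k - 16 * (k / (k + 3)) := by
  rw [profile, profile]; field_simp; ring

lemma averagePairs_sub (K : ℕ) : ∃ N : ℕ, 1 ≤ N ∧ ∀ n : ℕ, N ≤ n → ∀ j k : ℕ, j ≤ K → k ≤ K →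
    Even j → Even k → ∀ x y : List (Fin 3), IsIrreducible j x → IsIrreducible k y →
      |averagePairs (2 * n) x - averagePairs (2 * n) y
        - 3 / (16 * (n : ℝ)) * (profile k - profile j)| ≤ 1 / (8 * n) := by
  obtain ⟨N, hN1, hN⟩ := expansion K
  obtain ⟨B, hB⟩ : ∃ B : ℕ, B = 10000 * (K ^ 4 + 1) := ⟨_, rfl⟩
  refine ⟨N + 16 * B, by omega, fun n hn j k hj hk hje hke x y hx hy => ?_⟩
  have h1 := (hN n (by omega) j hj hje x hx).2
  have h2 := (hN n (by omega) k hk hke y hy).2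
  have n0 : (0 : ℝ) < n := by
    have : 0 < n := by omega
    exact_mod_cast this
  have nB : 16 * (B : ℝ) ≤ n := by
    have : 16 * B ≤ n := by omega
    exact_mod_cast this
  have small : ∀ i : ℕ, i ≤ K → 10000 * ((i : ℝ) ^ 4 + 1) / (n : ℝ) ^ 2 ≤ 1 / (16 * n) := by
    intro i hi
    have hiB : 10000 * ((i : ℝ) ^ 4 + 1) ≤ B := by
      have : 10000 * (i ^ 4 + 1) ≤ B := by rw [hB]; gcongr
      exact_mod_cast this
    rw [div_le_div_iff₀ (by positivity) (by positivity)]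
    nlinarith
  have e : averagePairs (2 * n) x - averagePairs (2 * n) y
        - 3 / (16 * (n : ℝ)) * (profile k - profile j)
      = (averagePairs (2 * n) x - mainTerm n j) - (averagePairs (2 * n) y - mainTerm n k) := by
    rw [mainTerm_eq, mainTerm_eq]; ring
  rw [e]
  refine (abs_sub _ _).trans ((add_le_add (h1.trans (small j hj)) (h2.trans (small k hk))).trans ?_)
  apply le_of_eq
  field_simp
  norm_num

lemma isIrreducible_nil : IsIrreducible 0 ([] : List (Fin 3)) := ⟨rfl, List.isChain_nil⟩

lemma averagePairs_lt (K : ℕ) : ∃ N : ℕ, ∀ n : ℕ, N ≤ n → ∀ j k : ℕ, j < k → k ≤ K →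
    Even j → Even k → ∀ x y : List (Fin 3), IsIrreducible j x → IsIrreducible k y →
      averagePairs (2 * n) y < averagePairs (2 * n) x := by
  obtain ⟨N, hN1, hN⟩ := averagePairs_sub K
  refine ⟨N, fun n hn j k hjk hk hje hke x y hx hy => ?_⟩
  have h := (abs_le.1 (hN n hn j k (by omega) hk hje hke x y hx hy)).1
  have n0 : (0 : ℝ) < n := by
    have : 0 < n := by omega
    exact_mod_cast this
  have hp : 3 / (16 * (n : ℝ)) * 3 ≤ 3 / (16 * (n : ℝ)) * (profile k - profile j) := by
    gcongr
    linarith [profile_gap hjk]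
  have : 1 / (8 * (n : ℝ)) < 3 / (16 * (n : ℝ)) * 3 := by
    rw [← mul_div_right_comm, div_lt_div_iff₀ (by positivity) (by positivity)]
    nlinarith
  linarith

/-- For `k = 0` both sides vanish, since the only string is the empty one; for `k ≥ 1` the error
of order `1 / n` is absorbed. -/
lemma averagePairs_nil_sub (K : ℕ) : ∃ N : ℕ, ∀ n : ℕ, N ≤ n → ∀ k : ℕ, k ≤ K → Even k →
    ∀ x : List (Fin 3), IsIrreducible k x →
      1 / 16 * (k : ℝ) ^ 2 / n
          ≤ averagePairs (2 * n) ([] : List (Fin 3)) - averagePairs (2 * n) x ∧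
      averagePairs (2 * n) ([] : List (Fin 3)) - averagePairs (2 * n) x
          ≤ 2 * (k : ℝ) ^ 2 / n ∧
      |averagePairs (2 * n) ([] : List (Fin 3)) - averagePairs (2 * n) x
          - 3 * (k : ℝ) ^ 2 / (16 * n)| ≤ 2 * (k : ℝ) / n := by
  obtain ⟨N, hN1, hN⟩ := averagePairs_sub K
  refine ⟨N, fun n hn k hk hke x hx => ?_⟩
  rcases Nat.eq_zero_or_pos k with rfl | hk0
  · obtain rfl : x = [] := List.length_eq_zero_iff.1 hx.1
    simp
  have h := hN n hn 0 k (by omega) hk (by simp) hke [] x isIrreducible_nil hx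
  have n0 : (0 : ℝ) < n := by
    have : 0 < n := by omega
    exact_mod_cast this
  have k1 : (1 : ℝ) ≤ k := by exact_mod_cast hk0
  rw [Nat.cast_zero, profile_sub_zero _ (by positivity)] at h
  set d := averagePairs (2 * n) ([] : List (Fin 3)) - averagePairs (2 * n) x
  obtain ⟨q, hq⟩ : ∃ q, q = (k : ℝ) / (k + 3) := ⟨_, rfl⟩
  have q0 : 0 ≤ q := by rw [hq]; positivity
  have q1 : 16 * q ≤ 6 * k := by
    rw [hq, ← mul_div_assoc, div_le_iff₀ (by positivity)]; nlinarith
  rw [← hq] at h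
  -- all quantities multiplied by `n`
  have h' : |n * d - 3 / 16 * ((k : ℝ) ^ 2 + 6 * k - 16 * q)| ≤ 1 / 8 := by
    have e : n * d - 3 / 16 * ((k : ℝ) ^ 2 + 6 * k - 16 * q)
        = n * (d - 3 / (16 * (n : ℝ)) * ((k : ℝ) ^ 2 + 6 * k - 16 * q)) := by
      field_simp
    rw [e, abs_mul, abs_of_pos n0]
    calc _ ≤ (n : ℝ) * (1 / (8 * n)) := by gcongr
      _ = 1 / 8 := by field_simp
  obtain ⟨hl, hu⟩ := abs_le.1 h'
  refine ⟨?_, ?_, ?_⟩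
  · rw [div_le_iff₀ n0]; nlinarith
  · rw [le_div_iff₀ n0]; nlinarith
  · rw [le_div_iff₀ n0, ← abs_of_pos n0, ← abs_mul, abs_of_pos n0]
    have e : (d - 3 * (k : ℝ) ^ 2 / (16 * n)) * n = n * d - 3 / 16 * (k : ℝ) ^ 2 := by
      field_simp
    rw [e, abs_le]
    constructor <;> nlinarith

lemma strictAnti_mainTerm {n : ℕ} (hn : 1 ≤ n) : StrictAnti fun k : ℕ => mainTerm n k := by
  intro j k hjk
  have n0 : (0 : ℝ) < n := by exact_mod_cast hn
  have h := profile_gap hjk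
  simp only [mainTerm_eq]
  have : profile j < profile k := by linarith
  gcongr

end PairFlip

theorem mainTheorem9 :
    -- the expansion; the constant in the error term depends neither on `n` nor on `k`
    (∃ C : ℝ, 0 < C ∧ ∀ K : ℕ, ∃ N : ℕ, ∀ n : ℕ, N ≤ n → ∀ k : ℕ, k ≤ K → Even k →
      ∀ x : List (Fin 3), PairFlip.IsIrreducible k x →
        (PairFlip.words (2 * n) x).Nonempty ∧
        |PairFlip.averagePairs (2 * n) x - PairFlip.mainTerm n k|
          ≤ C * ((k : ℝ) ^ 4 + 1) / (n : ℝ) ^ 2) ∧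
    -- the main terms decrease strictly with `k`
    (∀ n : ℕ, 1 ≤ n → StrictAnti fun k : ℕ => PairFlip.mainTerm n k) ∧
    -- for bounded `k` and large `n` the average itself is maximal at `k = 0` only
    (∀ K : ℕ, ∃ N : ℕ, ∀ n : ℕ, N ≤ n → ∀ k : ℕ, 0 < k → k ≤ K → Even k →
      ∀ x : List (Fin 3), PairFlip.IsIrreducible k x →
        PairFlip.averagePairs (2 * n) x
          < PairFlip.averagePairs (2 * n) ([] : List (Fin 3))) ∧
    -- and it decreases strictly with `k`
    (∀ K : ℕ, ∃ N : ℕ, ∀ n : ℕ, N ≤ n → ∀ j k : ℕ, j < k → k ≤ K → Even j → Even k →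
      ∀ x y : List (Fin 3), PairFlip.IsIrreducible j x → PairFlip.IsIrreducible k y →
        PairFlip.averagePairs (2 * n) y < PairFlip.averagePairs (2 * n) x) ∧
    -- the gap to the fully reducible words is of order `k² / n`
    (∃ c₁ c₂ : ℝ, 0 < c₁ ∧ 0 < c₂ ∧ ∀ K : ℕ, ∃ N : ℕ, ∀ n : ℕ, N ≤ n →
      ∀ k : ℕ, k ≤ K → Even k → ∀ x : List (Fin 3), PairFlip.IsIrreducible k x →
        c₁ * (k : ℝ) ^ 2 / (n : ℝ)
            ≤ PairFlip.averagePairs (2 * n) ([] : List (Fin 3))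
              - PairFlip.averagePairs (2 * n) x ∧
        PairFlip.averagePairs (2 * n) ([] : List (Fin 3)) - PairFlip.averagePairs (2 * n) x
            ≤ c₂ * (k : ℝ) ^ 2 / (n : ℝ)) ∧
    -- and it is `3k² / (16n)` up to a relative error `O(1/k)`
    (∃ C : ℝ, 0 < C ∧ ∀ K : ℕ, ∃ N : ℕ, ∀ n : ℕ, N ≤ n → ∀ k : ℕ, k ≤ K → Even k →
      ∀ x : List (Fin 3), PairFlip.IsIrreducible k x →
        |PairFlip.averagePairs (2 * n) ([] : List (Fin 3)) - PairFlip.averagePairs (2 * n) x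
            - 3 * (k : ℝ) ^ 2 / (16 * (n : ℝ))|
          ≤ C * (k : ℝ) / (n : ℝ)) := by
  refine ⟨⟨10000, by norm_num, fun K => ?_⟩, fun n hn => PairFlip.strictAnti_mainTerm hn,
    fun K => ?_, PairFlip.averagePairs_lt, ⟨1 / 16, 2, by norm_num, by norm_num, fun K => ?_⟩,
    ⟨2, by norm_num, fun K => ?_⟩⟩
  · obtain ⟨N, _, hN⟩ := PairFlip.expansion K
    exact ⟨N, hN⟩
  · obtain ⟨N, hN⟩ := PairFlip.averagePairs_lt K
    exact ⟨N, fun n hn k hk0 hk hke x hx =>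
      hN n hn 0 k hk0 hk (by simp) hke [] x PairFlip.isIrreducible_nil hx⟩
  · obtain ⟨N, hN⟩ := PairFlip.averagePairs_nil_sub K
    exact ⟨N, fun n hn k hk hke x hx =>
      ⟨(hN n hn k hk hke x hx).1, (hN n hn k hk hke x hx).2.1⟩⟩
  · obtain ⟨N, hN⟩ := PairFlip.averagePairs_nil_sub K
    exact ⟨N, fun n hn k hk hke x hx => (hN n hn k hk hke x hx).2.2⟩
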